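/- For an integer $n\ge 1$ let $[n]=\{1,\dots,n\}$. Call a set $S$ of natural numbers coprime-free if $\gcd(i,j)>1$ for all $i\neq j$ in $S$. Let $\mathcal F_n$ be the set of coprime-free subsets of $[n]$, ordered by inclusion, and let $L_n=\mathcal F_n\cup\{\widehat 1\}$ be the lattice obtained by adjoining an artificial top element $\widehat 1$; its bottom element is $\emptyset$. Let $\Delta_n$ be the cross-cut complex of the coatoms of $L_n$: its vertices are the coatoms of $L_n$ (the elements covered by $\widehat 1$), and a set of coatoms is a face if and only if it is not spanning, where a set is spanning if its join is $\widehat 1$ and its meet is $\emptyset$. Let $\widetilde H_k$ denote reduced simplicial homology with integer coefficients. Then $$\widetilde H_0(\Delta_1)=0,\qquad \widetilde H_0(\Delta_2)\cong\mathbb Z,\qquad \widetilde H_0(\Delta_3)\cong\mathbb Z^2,$$ and for every $n\ge 4$ we have $\widetilde H_0(\Delta_n)\cong\mathbb Z^{C(n)+1}$, where $C(n)$ is the number of primes in the interval $(n/2,n]$. Furthermore, $\widetilde H_1(\Delta_n)=0$ for every $n\ge 1$. -/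

import Mathlib

/-! ### Reduced simplicial homology with integer coefficients -/

namespace PreAbstractSimplicialComplex

variable {V : Type*}

open Classical in
/-- The ordered simplices of `K` with `m` vertices: tuples `(v_0, …, v_{m-1})`, repetitions allowed,
whose set of vertices is a face of `K`. The empty tuple is the unique ordered simplex with `0`
vertices. -/
def OrderedSimplex (K : PreAbstractSimplicialComplex V) (m : ℕ) : Type _ :=
  {f : Fin m → V // m = 0 ∨ Finset.univ.image f ∈ K.faces}

/-- The ordered simplex obtained by leaving out the `i`-th vertex. -/
def OrderedSimplex.erase {K : PreAbstractSimplicialComplex V} {m : ℕ}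
    (f : K.OrderedSimplex (m + 1)) (i : Fin (m + 1)) : K.OrderedSimplex m :=
  ⟨fun j => f.1 (i.succAbove j), by
    classical
    rcases Nat.eq_zero_or_pos m with rfl | hm
    · exact Or.inl rfl
    · refine Or.inr ((K.isRelLowerSet_faces (f.2.resolve_left (Nat.succ_ne_zero m))).2 ?_ ?_)
      · intro x hx
        obtain ⟨j, -, rfl⟩ := Finset.mem_image.1 hx
        exact Finset.mem_image_of_mem _ (Finset.mem_univ _)
      · exact ⟨_, Finset.mem_image_of_mem _ (Finset.mem_univ (⟨0, hm⟩ : Fin m))⟩⟩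

/-- The augmented ordered simplicial chain complex of `K` over `ℤ`. The module `K.OrderedChains m`
is free on the ordered simplices with `m` vertices, so it sits in dimension `m - 1`; for `m = 0` it
is a copy of `ℤ`, the target of the augmentation. -/
abbrev OrderedChains (K : PreAbstractSimplicialComplex V) (m : ℕ) : Type _ :=
  K.OrderedSimplex m →₀ ℤ

/-- The boundary map `∂ (v_0, …, v_m) = ∑ i, (-1) ^ i (v_0, …, v_{i-1}, v_{i+1}, …, v_m)`. For
`m = 0` this is the augmentation, which sends every vertex to `1`. -/
noncomputable def boundary (K : PreAbstractSimplicialComplex V) (m : ℕ) :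
    K.OrderedChains (m + 1) →ₗ[ℤ] K.OrderedChains m :=
  Finsupp.linearCombination ℤ fun f =>
    ∑ i : Fin (m + 1), (-1 : ℤ) ^ (i : ℕ) • Finsupp.single (f.erase i) (1 : ℤ)

theorem boundary_boundary (K : PreAbstractSimplicialComplex V) (m : ℕ)
    (c : K.OrderedChains (m + 2)) : K.boundary m (K.boundary (m + 1) c) = 0 := by
  suffices h : (K.boundary m).comp (K.boundary (m + 1)) = 0 from LinearMap.congr_fun h c
  apply Finsupp.lhom_ext'
  intro f
  apply LinearMap.ext_ring
  simp only [boundary, LinearMap.comp_apply, Finsupp.lsingle_apply,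
    Finsupp.linearCombination_single, map_sum, map_smul, LinearMap.zero_apply,
    Finset.smul_sum, ← Finset.sum_product', smul_smul]
  refine Finset.sum_involution (fun p _ => (p.1.succAbove p.2, p.2.predAbove p.1)) ?_ ?_ ?_ ?_
  · rintro ⟨i, j⟩ -
    have he : (f.erase i).erase j = (f.erase (i.succAbove j)).erase (j.predAbove i) :=
      Subtype.ext (funext fun k =>
        congrArg f.1 (Fin.succAbove_succAbove_succAbove_predAbove i j k).symm)
    have hs : (-1 : ℤ) ^ (i : ℕ) * (-1) ^ (j : ℕ)
        + (-1) ^ (i.succAbove j : ℕ) * (-1) ^ (j.predAbove i : ℕ) = 0 := by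
      rcases lt_or_ge j.castSucc i with h | h
      · rw [Fin.succAbove_of_castSucc_lt _ _ h, Fin.predAbove_of_castSucc_lt _ _ h]
        have h1 : (i : ℕ) = (i.pred (Fin.ne_zero_of_lt h) : ℕ) + 1 := by
          have : 0 < (i : ℕ) := lt_of_le_of_lt (Nat.zero_le _) (Fin.lt_def.1 h)
          simp only [Fin.val_pred]
          omega
        rw [h1, Fin.val_castSucc]
        ring
      · rw [Fin.succAbove_of_le_castSucc _ _ h, Fin.predAbove_of_le_castSucc _ _ h]
        have h1 : ∀ hi, ((i.castPred hi : Fin (m + 1)) : ℕ) = (i : ℕ) := fun _ => rfl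
        rw [h1, Fin.val_succ]
        ring
    simp only [he, ← add_smul, one_mul, hs, zero_smul]
  · rintro ⟨i, j⟩ - - h
    exact Fin.succAbove_ne i j (congrArg Prod.fst h)
  · intro p _
    exact Finset.mem_product.2 ⟨Finset.mem_univ _, Finset.mem_univ _⟩
  · rintro ⟨i, j⟩ -
    exact Prod.ext (Fin.succAbove_succAbove_predAbove i j)
      (Fin.predAbove_predAbove_succAbove i j)

/-- The `k`-cycles of the augmented ordered chain complex. -/
noncomputable def reducedCycles (K : PreAbstractSimplicialComplex V) (k : ℕ) :
    Submodule ℤ (K.OrderedChains (k + 1)) :=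
  LinearMap.ker (K.boundary k)

/-- The `k`-boundaries, as a submodule of the `k`-cycles. -/
noncomputable def reducedBoundaries (K : PreAbstractSimplicialComplex V) (k : ℕ) :
    Submodule ℤ (K.reducedCycles k) :=
  LinearMap.range ((K.boundary (k + 1)).codRestrict (K.reducedCycles k) fun c =>
    LinearMap.mem_ker.2 (K.boundary_boundary k c))

/-- The `k`-th reduced simplicial homology group of `K` with coefficients in `ℤ`. -/
abbrev ReducedHomology (K : PreAbstractSimplicialComplex V) (k : ℕ) : Type _ :=
  K.reducedCycles k ⧸ K.reducedBoundaries k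

end PreAbstractSimplicialComplex

/-! ### Cross-cut complexes -/

section CrossCut

variable {L : Type*} [Lattice L] [BoundedOrder L]

/-- A finite subset of a bounded lattice is spanning if its join is the top element and its meet is
the bottom element. -/
def IsSpanning (s : Finset L) : Prop :=
  s.sup id = ⊤ ∧ s.inf id = ⊥

/-- The complex whose faces are the nonempty finite subsets of `C` that are not spanning. -/
def crossCutComplex (C : Set L) : PreAbstractSimplicialComplex L where
  faces := {s | s.Nonempty ∧ (s : Set L) ⊆ C ∧ ¬ IsSpanning s}
  isRelLowerSet_faces := by
    rintro s ⟨hs, hC, hsp⟩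
    refine ⟨hs, fun t hts ht => ⟨ht, fun x hx => hC (hts hx), fun h => hsp ⟨?_, ?_⟩⟩⟩
    · exact top_le_iff.1 (h.1 ▸ Finset.sup_mono hts)
    · exact le_bot_iff.1 (h.2 ▸ Finset.inf_mono hts)

end CrossCut

/-! ### The lattice of coprime-free sets -/

/-- A set of natural numbers is coprime-free if any two distinct elements have gcd greater
than `1`. -/
def CoprimeFree (s : Set ℕ) : Prop :=
  ∀ i ∈ s, ∀ j ∈ s, i ≠ j → 1 < Nat.gcd i j

/-- The coprime-free subsets of `{1, …, n}`, ordered by inclusion. -/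
abbrev CoprimeFreeSubsets (n : ℕ) : Type :=
  {s : Finset ℕ // s ⊆ Finset.Icc 1 n ∧ CoprimeFree (s : Set ℕ)}

theorem CoprimeFree.mono {s t : Set ℕ} (h : s ⊆ t) (ht : CoprimeFree t) : CoprimeFree s :=
  fun i hi j hj => ht i (h hi) j (h hj)

instance (n : ℕ) : SemilatticeInf (CoprimeFreeSubsets n) :=
  Subtype.semilatticeInf fun {_ _} hs _ =>
    ⟨Finset.inter_subset_left.trans hs.1,
      hs.2.mono (Finset.coe_subset.2 Finset.inter_subset_left)⟩

instance (n : ℕ) : OrderBot (CoprimeFreeSubsets n) where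
  bot := ⟨∅, Finset.empty_subset _, fun i hi => absurd hi (by simp)⟩
  bot_le s := Finset.empty_subset s.1

/-- The coprime-free subsets of `{1, …, n}`, ordered by inclusion, with an artificial top element
adjoined. -/
abbrev CoprimeFreeLattice (n : ℕ) : Type :=
  WithTop (CoprimeFreeSubsets n)

open Classical in
/-- The join: the union if it is coprime-free, and the artificial top element otherwise. -/
noncomputable def CoprimeFreeLattice.join {n : ℕ} : CoprimeFreeLattice n → CoprimeFreeLattice n →
    CoprimeFreeLattice n
  | (s : CoprimeFreeSubsets n), (t : CoprimeFreeSubsets n) =>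
      if h : CoprimeFree ((s.1 ∪ t.1 : Finset ℕ) : Set ℕ) then
        ((⟨s.1 ∪ t.1, Finset.union_subset s.2.1 t.2.1, h⟩ : CoprimeFreeSubsets n) :
          CoprimeFreeLattice n)
      else ⊤
  | ⊤, _ => ⊤
  | _, ⊤ => ⊤

noncomputable instance (n : ℕ) : Lattice (CoprimeFreeLattice n) where
  __ := (inferInstance : SemilatticeInf (WithTop (CoprimeFreeSubsets n)))
  sup := CoprimeFreeLattice.join
  le_sup_left a b := by
    induction a using WithTop.recTopCoe <;> induction b using WithTop.recTopCoe <;>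
      simp only [CoprimeFreeLattice.join, le_top]
    split_ifs
    · exact WithTop.coe_le_coe.2 Finset.subset_union_left
    · exact le_top
  le_sup_right a b := by
    induction a using WithTop.recTopCoe <;> induction b using WithTop.recTopCoe <;>
      simp only [CoprimeFreeLattice.join, le_top]
    split_ifs
    · exact WithTop.coe_le_coe.2 Finset.subset_union_right
    · exact le_top
  sup_le a b c hac hbc := by
    induction c using WithTop.recTopCoe with
    | top => exact le_top
    | coe c =>
      induction a using WithTop.recTopCoe with
      | top => exact absurd (top_le_iff.1 hac) (WithTop.coe_ne_top)
      | coe a =>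
        induction b using WithTop.recTopCoe with
        | top => exact absurd (top_le_iff.1 hbc) (WithTop.coe_ne_top)
        | coe b =>
          have hac' : a ≤ c := WithTop.coe_le_coe.1 hac
          have hbc' : b ≤ c := WithTop.coe_le_coe.1 hbc
          have h : a.1 ∪ b.1 ⊆ c.1 := Finset.union_subset hac' hbc'
          have hcf : CoprimeFree ((a.1 ∪ b.1 : Finset ℕ) : Set ℕ) :=
            c.2.2.mono (Finset.coe_subset.2 h)
          simp only [CoprimeFreeLattice.join, dif_pos hcf]
          exact WithTop.coe_le_coe.2 h

/-- The cross-cut complex of the set of coatoms of the lattice of coprime-free subsets of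
`{1, …, n}`. -/
noncomputable def coprimeFreeComplex (n : ℕ) :
    PreAbstractSimplicialComplex (CoprimeFreeLattice n) :=
  crossCutComplex {x : CoprimeFreeLattice n | IsCoatom x}

/-- The number of primes in the interval `(n/2, n]`. -/
def upperHalfPrimeCount (n : ℕ) : ℕ :=
  {p ∈ Finset.Icc 1 n | n < 2 * p ∧ p.Prime}.card

/-!
Two distinct coatoms of the lattice have join `⊤`, so a set of coatoms is a face exactly when the
corresponding maximal coprime-free sets have a common element (`mem_faces_iff`). Hence the complex
is the nerve of the maximal cliques of the graph on `{1, …, n}` that joins numbers with a common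
factor, and by Dowker duality it behaves like the clique complex of that graph.

In the graph, `1` and the primes `p > n / 2` are isolated. Every other number has a prime factor
`p ≤ n / 2` and is joined to `2` through `2 * p`. This gives the components, and with them reduced
homology in degree `0` (`PreAbstractSimplicialComplex.reducedHomology_zero_equiv`). For `n ≤ 3`
every vertex is isolated, and there are `n` components.

Homology in degree `1` vanishes because every `1`-cocycle, with any coefficients, is a coboundary
(`PreAbstractSimplicialComplex.subsingleton_reducedHomology_one`). A cocycle on the nerve transfers
to one on the clique complex and a potential for it transfers back (`exists_potential_of_dual`). On
the clique complex the potential at `x` is the value of the cocycle along the path `2`, `2 * p`,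
`x`, for a prime `p ∣ x`; since `{2 * p, 2 * q, x}` is a clique when `p` and `q` divide `x`, the
choice of `p` is immaterial (`exists_potential_nonCoprime`).
-/

/-! ### Reduced homology in degrees zero and one -/

namespace PreAbstractSimplicialComplex

theorem boundary_one_single {V : Type*} (K : PreAbstractSimplicialComplex V)
    (f : K.OrderedSimplex 2) : K.boundary 1 (Finsupp.single f 1) =
      Finsupp.single (f.erase 0) 1 - Finsupp.single (f.erase 1) 1 := by
  rw [boundary, Finsupp.linearCombination_single, one_smul]
  refine (Fin.sum_univ_two _).trans ?_
  simp [sub_eq_add_neg]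

theorem boundary_two_single {V : Type*} (K : PreAbstractSimplicialComplex V)
    (f : K.OrderedSimplex 3) : K.boundary 2 (Finsupp.single f 1) =
      Finsupp.single (f.erase 0) 1 - Finsupp.single (f.erase 1) 1 +
        Finsupp.single (f.erase 2) 1 := by
  rw [boundary, Finsupp.linearCombination_single, one_smul]
  refine (Fin.sum_univ_three _).trans ?_
  simp [sub_eq_add_neg]

theorem singleton_mem_faces {V : Type*} (K : PreAbstractSimplicialComplex V) {t : Finset V}
    (ht : t ∈ K.faces) {A : V} (hA : A ∈ t) : {A} ∈ K.faces :=
  (K.isRelLowerSet_faces ht).2 (by simpa) (by simp)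

open Classical in
theorem image_mem_faces {V : Type*} (K : PreAbstractSimplicialComplex V) {m : ℕ}
    (f : Fin (m + 1) → V) {t : Finset V} (ht : t ∈ K.faces) (hf : ∀ i, f i ∈ t) :
    Finset.univ.image f ∈ K.faces :=
  (K.isRelLowerSet_faces ht).2 (Finset.image_subset_iff.2 fun i _ => hf i) (by simp)

/-- A complex has no reduced homology in degree `1` as soon as every `1`-cocycle, with any
coefficients, is a coboundary. It suffices to apply this to the universal cocycle, which sends an
edge to its class modulo boundaries. -/
theorem subsingleton_reducedHomology_one.{u} {V : Type u} (K : PreAbstractSimplicialComplex V)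
    (H : ∀ (Q : Type u) [AddCommGroup Q] (g : V → V → Q),
      (∀ A B C, (∃ s ∈ K.faces, A ∈ s ∧ B ∈ s ∧ C ∈ s) → g A B + g B C = g A C) →
      ∃ h : V → Q, ∀ A B, (∃ s ∈ K.faces, A ∈ s ∧ B ∈ s) → g A B = h B - h A) :
    Subsingleton (K.ReducedHomology 1) := by
  classical
  set R := LinearMap.range (K.boundary 2)
  let g : V → V → (K.OrderedChains 2 ⧸ R) := fun A B =>
    if h : (2 = 0 ∨ Finset.univ.image ![A, B] ∈ K.faces) then
      R.mkQ (Finsupp.single (⟨![A, B], by convert h⟩ : K.OrderedSimplex 2) 1) else 0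
  have hg : ∀ f : K.OrderedSimplex 2, g (f.1 0) (f.1 1) = R.mkQ (Finsupp.single f 1) := by
    intro f
    have e : ![f.1 0, f.1 1] = f.1 := by
      ext i; fin_cases i <;> rfl
    have hf : (2 = 0 ∨ Finset.univ.image ![f.1 0, f.1 1] ∈ K.faces) := by
      rw [e]; convert f.2
    simp only [g]
    rw [dif_pos hf]
    congr 2
    exact Subtype.ext e
  obtain ⟨h, hh⟩ := H _ g (by
    rintro A B C ⟨s, hs, hA, hB, hC⟩
    let f : K.OrderedSimplex 3 := ⟨![A, B, C],
      Or.inr (K.image_mem_faces _ hs (by intro i; fin_cases i <;> simpa))⟩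
    have hz : R.mkQ (K.boundary 2 (Finsupp.single f 1)) = 0 := by
      rw [Submodule.mkQ_apply, Submodule.Quotient.mk_eq_zero]
      exact ⟨_, rfl⟩
    have h0 := hg (f.erase 0)
    have h1 := hg (f.erase 1)
    have h2 := hg (f.erase 2)
    change g B C = _ at h0
    change g A C = _ at h1
    change g A B = _ at h2
    rw [h0, h1, h2]
    rw [boundary_two_single, map_add, map_sub] at hz
    rw [← sub_eq_zero, ← hz]
    abel)
  refine Submodule.Quotient.subsingleton_iff.2 ?_
  rw [eq_top_iff]
  rintro ⟨c, hc⟩ -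
  have hc' : K.boundary 1 c = 0 := hc
  let η : K.OrderedChains 1 →ₗ[ℤ] (K.OrderedChains 2 ⧸ R) :=
    Finsupp.linearCombination ℤ fun f => h (f.1 0)
  have hη : R.mkQ = η ∘ₗ K.boundary 1 := by
    apply Finsupp.lhom_ext'
    intro f
    apply LinearMap.ext_ring
    have := hh (f.1 0) (f.1 1) ⟨_, f.2.resolve_left (by norm_num),
      Finset.mem_image_of_mem _ (Finset.mem_univ _), Finset.mem_image_of_mem _ (Finset.mem_univ _)⟩
    rw [hg] at this
    simp only [LinearMap.comp_apply, Finsupp.lsingle_apply, this, boundary_one_single, map_sub,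
      Finsupp.linearCombination_single, one_smul, η]
    rfl
  have hcR : c ∈ R := by
    rw [← Submodule.Quotient.mk_eq_zero, ← Submodule.mkQ_apply, hη, LinearMap.comp_apply, hc',
      map_zero]
  obtain ⟨d, hd⟩ := hcR
  exact ⟨d, Subtype.ext hd⟩

/-- If the map `κ` to `Option J` is constant on edges and has connected nonempty fibres, so that
the connected components are indexed by `Option J`, then reduced homology in degree `0` is free on
`J`: the class of a cycle is determined by its coefficient sums over the components in `J`. -/
theorem reducedHomology_zero_equiv {V J : Type*} [Fintype J] [DecidableEq J]
    (K : PreAbstractSimplicialComplex V) (κ : V → Option J) (s : Option J → V)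
    (hs : ∀ i, {s i} ∈ K.faces) (hκs : ∀ i, κ (s i) = i)
    (hκ : ∀ A B, (∃ t ∈ K.faces, A ∈ t ∧ B ∈ t) → κ A = κ B)
    (hconn : ∀ A, {A} ∈ K.faces →
      Relation.EqvGen (fun A B => ∃ t ∈ K.faces, A ∈ t ∧ B ∈ t) A (s (κ A))) :
    Nonempty (K.ReducedHomology 0 ≃+ (J → ℤ)) := by
  classical
  have himg : ∀ f : Fin 1 → V, Finset.univ.image f = {f 0} := by
    intro f; ext; simp
  let vtx : ∀ A, {A} ∈ K.faces → K.OrderedSimplex 1 := fun A hA =>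
    ⟨![A], Or.inr (by convert hA; exact himg ![A])⟩
  have hvtx : ∀ f : K.OrderedSimplex 1, {f.1 0} ∈ K.faces := by
    intro f
    have := f.2.resolve_left one_ne_zero
    rw [← himg]
    convert this
  have hvtx' : ∀ f : K.OrderedSimplex 1, vtx (f.1 0) (hvtx f) = f := by
    intro f
    apply Subtype.ext
    ext i
    fin_cases i
    rfl
  set R := LinearMap.range (K.boundary 1)
  have hedge : ∀ A B (hA : {A} ∈ K.faces) (hB : {B} ∈ K.faces),
      Relation.EqvGen (fun A B => ∃ t ∈ K.faces, A ∈ t ∧ B ∈ t) A B →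
      R.mkQ (Finsupp.single (vtx A hA) 1) = R.mkQ (Finsupp.single (vtx B hB) 1) := by
    -- Vertices off the complex are given the value `0`, so that the class is defined on all of `V`.
    let q : V → K.OrderedChains 1 ⧸ R := fun A =>
      if hA : {A} ∈ K.faces then R.mkQ (Finsupp.single (vtx A hA) 1) else 0
    have hq : ∀ A B, Relation.EqvGen (fun A B => ∃ t ∈ K.faces, A ∈ t ∧ B ∈ t) A B → q A = q B := by
      intro A B hAB
      induction hAB with
      | rel A B h =>
        obtain ⟨t, ht, hA, hB⟩ := h
        have hA' : {A} ∈ K.faces := K.singleton_mem_faces ht hA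
        have hB' : {B} ∈ K.faces := K.singleton_mem_faces ht hB
        have hf := K.image_mem_faces ![A, B] ht (by intro i; fin_cases i <;> simpa)
        let f : K.OrderedSimplex 2 := ⟨![A, B], Or.inr hf⟩
        have e0 : f.erase 0 = vtx B hB' := by
          apply Subtype.ext; ext i; fin_cases i; rfl
        have e1 : f.erase 1 = vtx A hA' := by
          apply Subtype.ext; ext i; fin_cases i; rfl
        have hz : R.mkQ (K.boundary 1 (Finsupp.single f 1)) = 0 := by
          rw [Submodule.mkQ_apply, Submodule.Quotient.mk_eq_zero]
          exact ⟨_, rfl⟩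
        rw [boundary_one_single, e0, e1, map_sub] at hz
        simp only [q, dif_pos hA', dif_pos hB']
        exact (sub_eq_zero.1 hz).symm
      | refl A => rfl
      | symm A B _ ih => exact ih.symm
      | trans A B C _ _ ih ih' => exact ih.trans ih'
    intro A B hA hB hAB
    have := hq A B hAB
    simpa only [q, dif_pos hA, dif_pos hB] using this
  let δ : Option J → J → ℤ := fun i => i.elim 0 fun j => Pi.single j 1
  let φ : K.OrderedChains 1 →ₗ[ℤ] (J → ℤ) := Finsupp.linearCombination ℤ fun f => δ (κ (f.1 0))
  let b : Option J → K.OrderedChains 1 := fun i => Finsupp.single (vtx (s i) (hs i)) 1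
  let ψ : (J → ℤ) →ₗ[ℤ] K.OrderedChains 1 :=
    Fintype.linearCombination ℤ fun j => b (some j) - b none
  let pt : K.OrderedSimplex 0 := ⟨Fin.elim0, Or.inl rfl⟩
  have hpt : ∀ x : K.OrderedSimplex 0, x = pt := fun x => Subtype.ext (Subsingleton.elim _ _)
  have haug : ∀ f, K.boundary 0 (Finsupp.single f 1) = Finsupp.single pt 1 := by
    intro f
    simp [boundary, hpt]
  have hφR : ∀ d, φ (K.boundary 1 d) = 0 := by
    intro d
    suffices h : φ.comp (K.boundary 1) = 0 from LinearMap.congr_fun h d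
    apply Finsupp.lhom_ext'
    intro f
    apply LinearMap.ext_ring
    have := hκ (f.1 0) (f.1 1) ⟨_, f.2.resolve_left (by norm_num),
      Finset.mem_image_of_mem _ (Finset.mem_univ _), Finset.mem_image_of_mem _ (Finset.mem_univ _)⟩
    have e0 : (f.erase 0).1 0 = f.1 1 := rfl
    have e1 : (f.erase 1).1 0 = f.1 0 := rfl
    simp [φ, boundary_one_single, e0, e1, this]
  -- A chain is homologous to a combination of the base points of the components.
  have hsplit : ∀ c, R.mkQ c = R.mkQ (K.boundary 0 c pt • b none + ψ (φ c)) := by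
    intro c
    suffices h : R.mkQ = R.mkQ.comp (((Finsupp.lapply pt).comp (K.boundary 0)).smulRight (b none)
        + ψ.comp φ) from LinearMap.congr_fun h c
    apply Finsupp.lhom_ext'
    intro f
    apply LinearMap.ext_ring
    have h1 : b none + ψ (δ (κ (f.1 0))) = b (κ (f.1 0)) := by
      cases κ (f.1 0) with
      | none => simp [δ]
      | some j => simp [δ, ψ]
    have h2 : φ (Finsupp.single f 1) = δ (κ (f.1 0)) := by simp [φ]
    simp only [LinearMap.comp_apply, Finsupp.lsingle_apply, LinearMap.add_apply,
      LinearMap.smulRight_apply, haug, h2, Finsupp.lapply_apply, Finsupp.single_eq_same, one_smul,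
      h1]
    have := hedge _ _ (hvtx f) (hs _) (hconn _ (hvtx f))
    rw [hvtx'] at this
    exact this
  let Φ : K.ReducedHomology 0 →ₗ[ℤ] (J → ℤ) :=
    (K.reducedBoundaries 0).liftQ (φ.comp (K.reducedCycles 0).subtype) (by
      rintro _ ⟨d, rfl⟩
      exact hφR d)
  refine ⟨(LinearEquiv.ofBijective Φ ⟨?_, ?_⟩).toAddEquiv⟩
  · rw [← LinearMap.ker_eq_bot, LinearMap.ker_eq_bot']
    intro x
    induction x using Submodule.Quotient.induction_on with | _ c =>
    intro hc
    obtain ⟨c, hc0⟩ := c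
    have hc1 : φ c = 0 := hc
    have hc0' : K.boundary 0 c = 0 := hc0
    have := hsplit c
    rw [hc1, hc0'] at this
    simp only [Finsupp.coe_zero, Pi.zero_apply, zero_smul, map_zero, add_zero] at this
    rw [Submodule.mkQ_apply, Submodule.Quotient.mk_eq_zero] at this
    obtain ⟨d, hd⟩ := this
    rw [Submodule.Quotient.mk_eq_zero]
    exact ⟨d, Subtype.ext hd⟩
  · intro y
    have hy : ψ y ∈ K.reducedCycles 0 := by
      change K.boundary 0 (ψ y) = 0
      simp [ψ, Fintype.linearCombination_apply, b, haug]
    refine ⟨Submodule.Quotient.mk ⟨ψ y, hy⟩, ?_⟩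
    change φ (ψ y) = y
    have h3 : ∀ i, φ (b i) = δ i := by
      intro i
      have : (vtx (s i) (hs i)).1 0 = s i := rfl
      simp [φ, b, this, hκs]
    simp only [ψ, Fintype.linearCombination_apply, map_sum, map_smul, map_sub, h3]
    ext j
    simp [δ, Finset.sum_apply, Pi.single_apply]

end PreAbstractSimplicialComplex

/-! ### Duality for cocycles -/

/-- Duality for cocycles. Let `R` be a relation between `V` and `X`. If every `1`-cocycle on the
complex of finite subsets of `X` related to a common element of `V` is a coboundary, then the same
holds for the complex of finite subsets of `V` related to a common element of `X`. -/
theorem exists_potential_of_dual {V X Q : Type*} [AddCommGroup Q] (R : V → X → Prop)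
    (hX : ∀ e : X → X → Q,
      (∀ A x y z, R A x → R A y → R A z → e x y + e y z = e x z) →
      ∃ k : X → Q, ∀ A x y, R A x → R A y → e x y = k y - k x)
    (g : V → V → Q)
    (hg : ∀ x A B C, R A x → R B x → R C x → g A B + g B C = g A C) :
    ∃ h : V → Q, ∀ x A B, R A x → R B x → g A B = h B - h A := by
  classical
  rcases isEmpty_or_nonempty V with hV | hV
  · exact ⟨fun _ => 0, fun _ A => hV.elim A⟩
  have hM : ∀ x, ∃ A, (∃ B, R B x) → R A x := by
    intro x
    by_cases h : ∃ B, R B x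
    · exact ⟨h.choose, fun _ => h.choose_spec⟩
    · exact ⟨Classical.arbitrary V, fun h' => (h h').elim⟩
  choose M hM using hM
  have hM' : ∀ {A x}, R A x → R (M x) x := fun h => hM _ ⟨_, h⟩
  -- Dual cocycle: go from the chosen `M x` to `M y` through any `N` related to both `x` and `y`.
  let e : X → X → Q := fun x y =>
    if h : ∃ N, R N x ∧ R N y then g (M x) h.choose + g h.choose (M y) else 0
  have he : ∀ N x y, R N x → R N y → e x y = g (M x) N + g N (M y) := by
    intro N x y hx hy
    have h : ∃ N, R N x ∧ R N y := ⟨N, hx, hy⟩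
    simp only [e, dif_pos h]
    have h1 := hg x (M x) N h.choose (hM' hx) hx h.choose_spec.1
    have h2 := hg y N h.choose (M y) hy h.choose_spec.2 (hM' hy)
    rw [← h1, ← h2]
    abel
  have hself : ∀ {A x}, R A x → g A A = 0 := fun {A x} h => by simpa using hg x A A A h h h
  have hanti : ∀ {A B x}, R A x → R B x → g A B = - g B A := by
    intro A B x hA hB
    rw [eq_neg_iff_add_eq_zero, hg x A B A hA hB hA, hself hA]
  obtain ⟨k, hk⟩ := hX e (by
    intro A x y z hx hy hz
    rw [he A x y hx hy, he A y z hy hz, he A x z hx hz, hanti hy (hM' hy)]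
    abel)
  -- The potential transferred back does not depend on the element related to `A`.
  let h : V → Q := fun A => if H : ∃ x, R A x then k H.choose + g (M H.choose) A else 0
  have hh : ∀ A x, R A x → h A = k x + g (M x) A := by
    intro A x hx
    have H : ∃ x, R A x := ⟨x, hx⟩
    simp only [h, dif_pos H]
    have h1 := hk A x H.choose hx H.choose_spec
    rw [he A _ _ hx H.choose_spec, hanti H.choose_spec (hM' H.choose_spec)] at h1
    rw [← sub_eq_zero] at h1 ⊢
    rw [← neg_eq_zero, ← h1]
    abel
  refine ⟨h, fun x A B hA hB => ?_⟩
  rw [hh A x hA, hh B x hB, ← hg x (M x) A B (hM' hA) hA hB]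
  abel

/-! ### Faces of the complex of coprime-free sets -/

/-- A coatom `A` of the lattice, that is, a maximal coprime-free set, contains the number `x`. -/
def IsCoatomThrough (n : ℕ) (A : CoprimeFreeLattice n) (x : ℕ) : Prop :=
  IsCoatom A ∧ ∃ s : CoprimeFreeSubsets n, A = s ∧ x ∈ s.1

theorem IsCoatomThrough.mem_Icc {n : ℕ} {A : CoprimeFreeLattice n} {x : ℕ}
    (h : IsCoatomThrough n A x) : x ∈ Finset.Icc 1 n := by
  obtain ⟨-, s, -, hx⟩ := h
  exact s.2.1 hx

theorem IsCoatomThrough.eq_or_one_lt_gcd {n : ℕ} {A : CoprimeFreeLattice n} {x y : ℕ}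
    (hx : IsCoatomThrough n A x) (hy : IsCoatomThrough n A y) : x = y ∨ 1 < x.gcd y := by
  obtain ⟨-, s, rfl, hx⟩ := hx
  obtain ⟨-, t, hst, hy⟩ := hy
  obtain rfl : s = t := WithTop.coe_injective hst
  exact or_iff_not_imp_left.2 (s.2.2 x hx y hy)

theorem exists_isCoatomThrough {n : ℕ} {s : Finset ℕ} (hs : s ⊆ Finset.Icc 1 n)
    (h : CoprimeFree (s : Set ℕ)) : ∃ A, ∀ x ∈ s, IsCoatomThrough n A x := by
  have : Finite (CoprimeFreeSubsets n) :=
    ((Finset.Icc 1 n).powerset.finite_toSet.subset fun s hs =>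
      Finset.mem_coe.2 (Finset.mem_powerset.2 hs.1)).to_subtype
  have : Finite (CoprimeFreeLattice n) := inferInstanceAs (Finite (Option _))
  obtain hA | ⟨A, hA, hle⟩ := IsCoatomic.eq_top_or_exists_le_coatom
    (((⟨s, hs, h⟩ : CoprimeFreeSubsets n) : CoprimeFreeLattice n))
  · exact absurd hA WithTop.coe_ne_top
  · obtain ⟨t, rfl⟩ := WithTop.ne_top_iff_exists.1 hA.1
    exact ⟨t, fun x hx => ⟨hA, t, rfl, WithTop.coe_le_coe.1 hle hx⟩⟩

theorem coprimeFree_singleton (x : ℕ) : CoprimeFree (({x} : Finset ℕ) : Set ℕ) := by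
  intro i hi j hj h
  simp at hi hj
  omega

theorem IsCoatom.exists_through {n : ℕ} (hn : 1 ≤ n) {A : CoprimeFreeLattice n} (hA : IsCoatom A) :
    ∃ x, IsCoatomThrough n A x := by
  obtain ⟨t, rfl⟩ := WithTop.ne_top_iff_exists.1 hA.1
  by_contra! h
  have ht : t.1 = ∅ := Finset.eq_empty_of_forall_notMem fun x hx => h x ⟨hA, t, rfl, hx⟩
  let u : CoprimeFreeSubsets n := ⟨{1}, by simpa using hn, coprimeFree_singleton 1⟩
  have hlt : (t : CoprimeFreeLattice n) < u := by
    refine WithTop.coe_lt_coe.2 (lt_of_le_of_ne ?_ ?_)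
    · change t.1 ⊆ u.1
      simp [ht]
    · intro e
      have := congrArg Subtype.val e
      simp [ht, u] at this
  exact WithTop.coe_ne_top (hA.2 _ hlt)

/-- The complex is the nerve of the family of maximal coprime-free sets: the join of two distinct
coatoms is the top element, so a set of coatoms is a face exactly when it has a common element. -/
theorem mem_faces_iff {n : ℕ} (hn : 1 ≤ n) (t : Finset (CoprimeFreeLattice n)) :
    t ∈ (coprimeFreeComplex n).faces ↔ t.Nonempty ∧ ∃ x, ∀ A ∈ t, IsCoatomThrough n A x := by
  classical
  constructor
  · rintro ⟨hne, hC, hsp⟩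
    refine ⟨hne, ?_⟩
    by_contra! h
    refine hsp ⟨?_, ?_⟩
    · obtain ⟨A, hA⟩ := hne
      obtain ⟨x, hx⟩ := IsCoatom.exists_through hn (hC hA)
      obtain ⟨B, hB, hBx⟩ := h x
      have hAB : A ≠ B := by rintro rfl; exact hBx hx
      have hA' : IsCoatom A := hC hA
      have hB' : IsCoatom B := hC hB
      refine top_le_iff.1 ((hA'.sup_eq_top_of_ne hB' hAB).ge.trans ?_)
      exact sup_le (Finset.le_sup (f := id) hA) (Finset.le_sup (f := id) hB)
    · obtain ⟨A, hA⟩ := hne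
      have hlt : t.inf id ≤ A := Finset.inf_le (f := id) hA
      have hA' : IsCoatom A := hC hA
      obtain ⟨u, hu⟩ := WithTop.ne_top_iff_exists.1 (ne_top_of_le_ne_top hA'.1 hlt)
      rw [← hu]
      have hu0 : u.1 = ∅ := by
        refine Finset.eq_empty_of_forall_notMem fun x hx => ?_
        obtain ⟨B, hB, hBx⟩ := h x
        have hB' : IsCoatom B := hC hB
        have huB : (u : CoprimeFreeLattice n) ≤ B := by
          rw [hu]; exact Finset.inf_le (f := id) hB
        obtain ⟨v, rfl⟩ := WithTop.ne_top_iff_exists.1 hB'.1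
        exact hBx ⟨hB', v, rfl, WithTop.coe_le_coe.1 huB hx⟩
      have : u = ⊥ := Subtype.ext hu0
      rw [this]
      rfl
  · rintro ⟨hne, x, hx⟩
    refine ⟨hne, fun A hA => (hx A hA).1, fun hsp => ?_⟩
    obtain ⟨A, hA⟩ := hne
    let u : CoprimeFreeSubsets n :=
      ⟨{x}, by simpa using (hx A hA).mem_Icc, coprimeFree_singleton x⟩
    have hle : (u : CoprimeFreeLattice n) ≤ t.inf id := by
      refine Finset.le_inf fun B hB => ?_
      obtain ⟨-, v, rfl, hv⟩ := hx B hB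
      exact WithTop.coe_le_coe.2 (Finset.singleton_subset_iff.2 hv)
    rw [hsp.2] at hle
    have hle' : u ≤ ⊥ := WithTop.coe_le_coe.1 hle
    have hle' : u.1 ⊆ ∅ := hle'
    simp [u] at hle'

/-! ### The non-coprimality graph -/

theorem one_lt_gcd_of_prime_dvd {p x y : ℕ} (hp : p.Prime) (hx : p ∣ x) (hy : p ∣ y)
    (h0 : 0 < x) : 1 < x.gcd y :=
  hp.one_lt.trans_le (Nat.le_of_dvd (Nat.gcd_pos_of_pos_left _ h0) (Nat.dvd_gcd hx hy))

/-- In the non-coprimality graph of `{1, …, n}` every cocycle is a coboundary: the vertices `2 * p`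
form a clique, and a number with a prime factor `p ≤ n / 2` is joined to `2` through `2 * p`; the
triangles `2 * p`, `2 * q`, `x` show that the choice of `p` does not matter. -/
theorem exists_potential_nonCoprime {Q : Type*} [AddCommGroup Q] {n : ℕ} (e : ℕ → ℕ → Q)
    (he : ∀ A x y z, IsCoatomThrough n A x → IsCoatomThrough n A y → IsCoatomThrough n A z →
      e x y + e y z = e x z) :
    ∃ k : ℕ → Q, ∀ A x y, IsCoatomThrough n A x → IsCoatomThrough n A y → e x y = k y - k x := by
  classical
  have tri : ∀ {x y z}, x ∈ Finset.Icc 1 n → y ∈ Finset.Icc 1 n → z ∈ Finset.Icc 1 n →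
      (x ≠ y → 1 < x.gcd y) → (y ≠ z → 1 < y.gcd z) → (x ≠ z → 1 < x.gcd z) →
      e x y + e y z = e x z := by
    intro x y z hx hy hz hxy hyz hxz
    obtain ⟨A, hA⟩ := exists_isCoatomThrough (n := n) (s := {x, y, z})
      (by simp only [Finset.insert_subset_iff, Finset.singleton_subset_iff]; exact ⟨hx, hy, hz⟩) (by
        intro i hi j hj hij
        have h1 := Nat.gcd_comm x y
        have h2 := Nat.gcd_comm y z
        have h3 := Nat.gcd_comm x z
        simp only [Finset.coe_insert, Finset.coe_singleton, Set.mem_insert_iff,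
          Set.mem_singleton_iff] at hi hj
        rcases hi with rfl | rfl | rfl <;> rcases hj with rfl | rfl | rfl <;> grind)
    exact he A x y z (hA x (by simp)) (hA y (by simp)) (hA z (by simp))
  have hself : ∀ {x}, x ∈ Finset.Icc 1 n → e x x = 0 := fun {x} hx => by
    simpa using tri hx hx hx (fun h => (h rfl).elim) (fun h => (h rfl).elim) (fun h => (h rfl).elim)
  let k : ℕ → Q := fun x =>
    if h : ∃ p, p.Prime ∧ p ∣ x ∧ 2 * p ≤ n then e 2 (2 * h.choose) + e (2 * h.choose) x else 0
  have hk : ∀ {x p : ℕ}, x ∈ Finset.Icc 1 n → p.Prime → p ∣ x → 2 * p ≤ n →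
      k x = e 2 (2 * p) + e (2 * p) x := by
    intro x p hx hp hpx hpn
    have h : ∃ p, p.Prime ∧ p ∣ x ∧ 2 * p ≤ n := ⟨p, hp, hpx, hpn⟩
    simp only [k, dif_pos h]
    obtain ⟨hq, hqx, hqn⟩ := h.choose_spec
    set q := h.choose
    rw [Finset.mem_Icc] at hx
    have hp2 := hp.two_le
    have hq2 := hq.two_le
    have h2 : Nat.Prime 2 := Nat.prime_two
    rw [← tri (x := 2) (y := 2 * p) (z := 2 * q), ← tri (x := 2 * p) (y := 2 * q) (z := x)]
    · abel
    all_goals first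
      | (rw [Finset.mem_Icc]; omega)
      | (intro _
         first
         | exact one_lt_gcd_of_prime_dvd h2 (by simp) (by simp) (by omega)
         | exact one_lt_gcd_of_prime_dvd hp (by simp) hpx (by omega)
         | exact one_lt_gcd_of_prime_dvd hq (by simp) hqx (by omega))
  refine ⟨k, fun A x y hAx hAy => ?_⟩
  have hx := hAx.mem_Icc
  have hy := hAy.mem_Icc
  rcases eq_or_ne x y with rfl | hxy
  · rw [hself hx, sub_self]
  have hgcd := hAx.eq_or_one_lt_gcd hAy |>.resolve_left hxy
  obtain ⟨p, hp, hpg⟩ := Nat.exists_prime_and_dvd hgcd.ne'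
  have hpx := hpg.trans (Nat.gcd_dvd_left x y)
  have hpy := hpg.trans (Nat.gcd_dvd_right x y)
  have hx' := Finset.mem_Icc.1 hx
  have hy' := Finset.mem_Icc.1 hy
  have hp2 := hp.two_le
  -- One of two distinct multiples of `p` is at least `2 * p`.
  have hpn : 2 * p ≤ n := by
    obtain ⟨a, rfl⟩ := hpx
    obtain ⟨b, rfl⟩ := hpy
    have ha : a ≠ 0 := by rintro rfl; simp at hx'
    have hb : b ≠ 0 := by rintro rfl; simp at hy'
    have hab : a ≠ b := by rintro rfl; exact hxy rfl
    rcases (by omega : 2 ≤ a ∨ 2 ≤ b) with h | h <;> nlinarith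
  rw [hk hx hp hpx hpn, hk hy hp hpy hpn,
    ← tri (x := 2 * p) (y := x) (z := y) (Finset.mem_Icc.2 (by omega)) hx hy
      (fun _ => one_lt_gcd_of_prime_dvd hp (by simp) hpx (by omega)) (fun _ => hgcd)
      (fun _ => one_lt_gcd_of_prime_dvd hp (by simp) hpy (by omega))]
  abel

theorem exists_common_face_iff {n : ℕ} (hn : 1 ≤ n) {A B : CoprimeFreeLattice n} :
    (∃ t ∈ (coprimeFreeComplex n).faces, A ∈ t ∧ B ∈ t) ↔
      ∃ x, IsCoatomThrough n A x ∧ IsCoatomThrough n B x := by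
  classical
  constructor
  · rintro ⟨t, ht, hA, hB⟩
    obtain ⟨-, x, hx⟩ := (mem_faces_iff hn t).1 ht
    exact ⟨x, hx A hA, hx B hB⟩
  · rintro ⟨x, hA, hB⟩
    exact ⟨{A, B}, (mem_faces_iff hn _).2 ⟨by simp, x, by simp [hA, hB]⟩, by simp, by simp⟩

theorem subsingleton_reducedHomology_one_coprimeFreeComplex {n : ℕ} (hn : 1 ≤ n) :
    Subsingleton ((coprimeFreeComplex n).ReducedHomology 1) := by
  classical
  refine PreAbstractSimplicialComplex.subsingleton_reducedHomology_one _ fun Q _ g hg => ?_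
  obtain ⟨h, hh⟩ := exists_potential_of_dual (IsCoatomThrough n)
    (fun e he => exists_potential_nonCoprime e he) g (fun x A B C hA hB hC => hg A B C
      ⟨{A, B, C}, (mem_faces_iff hn _).2 ⟨by simp, x, by simp [hA, hB, hC]⟩, by simp, by simp,
        by simp⟩)
  refine ⟨h, fun A B hAB => ?_⟩
  obtain ⟨x, hA, hB⟩ := (exists_common_face_iff hn).1 hAB
  exact hh x A B hA hB

/-! ### Components -/

/-- If `J` consists of isolated vertices of the non-coprimality graph of `{1, …, n}`, and all
vertices outside `J` are connected to one vertex `b` outside `J`, then reduced homology in degree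
`0` is free on `J`: the components of the complex are the coatoms `{j}` for `j` in `J` and one
more component, which holds the coatoms through vertices outside `J`. -/
theorem reducedHomology_zero_equiv_of_isolated {n : ℕ} (J : Finset ℕ) (b : ℕ)
    (hJ : J ⊆ Finset.Icc 1 n) (hb : b ∈ Finset.Icc 1 n) (hbJ : b ∉ J)
    (hiso : ∀ j ∈ J, ∀ x ∈ Finset.Icc 1 n, 1 < j.gcd x → x = j)
    (hconn : ∀ x ∈ Finset.Icc 1 n, x ∉ J → Relation.EqvGen (fun x y =>
      x ∈ Finset.Icc 1 n ∧ y ∈ Finset.Icc 1 n ∧ 1 < x.gcd y) x b) :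
    Nonempty ((coprimeFreeComplex n).ReducedHomology 0 ≃+ (Fin J.card → ℤ)) := by
  classical
  have hn : 1 ≤ n := by have := Finset.mem_Icc.1 hb; omega
  have hM : ∀ x : ℕ, ∃ A, x ∈ Finset.Icc 1 n → IsCoatomThrough n A x := by
    intro x
    by_cases hx : x ∈ Finset.Icc 1 n
    · obtain ⟨A, hA⟩ := exists_isCoatomThrough (n := n) (s := {x}) (by simpa using hx)
        (coprimeFree_singleton x)
      exact ⟨A, fun _ => hA x (by simp)⟩
    · exact ⟨⊤, fun h => (hx h).elim⟩
  choose M hM using hM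
  let κ : CoprimeFreeLattice n → Option J := fun A =>
    if h : ∃ j : J, IsCoatomThrough n A j then some h.choose else none
  have huniq : ∀ {A} {j x : ℕ}, j ∈ J → IsCoatomThrough n A j → IsCoatomThrough n A x → x = j := by
    intro A j x hj hAj hAx
    rcases hAj.eq_or_one_lt_gcd hAx with h | h
    · exact h.symm
    · exact hiso j hj x hAx.mem_Icc h
  have hκ_some : ∀ {A} (j : J), IsCoatomThrough n A j → κ A = some j := by
    intro A j hj
    have h : ∃ j : J, IsCoatomThrough n A j := ⟨j, hj⟩
    simp only [κ, dif_pos h]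
    exact congrArg some (Subtype.ext (huniq j.2 hj h.choose_spec))
  have hκ_none : ∀ {A} {x : ℕ}, x ∉ J → IsCoatomThrough n A x → κ A = none := by
    intro A x hx hA
    refine dif_neg ?_
    rintro ⟨j, hj⟩
    exact hx (huniq j.2 hj hA ▸ j.2)
  let s : Option J → CoprimeFreeLattice n := fun i => i.elim (M b) fun j => M j
  have hMJ : ∀ j : J, IsCoatomThrough n (M j) j := fun j => hM _ (hJ j.2)
  have hsingle : ∀ {A} {x : ℕ}, IsCoatomThrough n A x → {A} ∈ (coprimeFreeComplex n).faces :=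
    fun {A x} h => (mem_faces_iff hn _).2 ⟨by simp, x, by simpa using h⟩
  -- A path in the graph gives a path of coatoms, through a coatom containing each edge.
  have hpath : ∀ {x y}, Relation.EqvGen (fun x y =>
      x ∈ Finset.Icc 1 n ∧ y ∈ Finset.Icc 1 n ∧ 1 < x.gcd y) x y →
      Relation.EqvGen (fun A B => ∃ x, IsCoatomThrough n A x ∧ IsCoatomThrough n B x)
        (M x) (M y) := by
    intro x y h
    induction h with
    | rel x y h =>
      obtain ⟨hx, hy, hxy⟩ := h
      obtain ⟨N, hN⟩ := exists_isCoatomThrough (n := n) (s := {x, y})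
        (by simp only [Finset.insert_subset_iff, Finset.singleton_subset_iff]; exact ⟨hx, hy⟩)
        (by
          intro i hi j hj hij
          have h1 := Nat.gcd_comm x y
          simp only [Finset.coe_insert, Finset.coe_singleton, Set.mem_insert_iff,
            Set.mem_singleton_iff] at hi hj
          rcases hi with rfl | rfl <;> rcases hj with rfl | rfl <;> grind)
      exact .trans _ N _ (.rel _ _ ⟨x, hM x hx, hN x (by simp)⟩)
        (.rel _ _ ⟨y, hN y (by simp), hM y hy⟩)
    | refl x => exact .refl _
    | symm x y _ ih => exact .symm _ _ ih
    | trans x y z _ _ ih ih' => exact .trans _ _ _ ih ih'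
  have main := PreAbstractSimplicialComplex.reducedHomology_zero_equiv (coprimeFreeComplex n) κ s
    (by
      rintro (_ | j)
      · exact hsingle (hM b hb)
      · exact hsingle (hMJ j))
    (by
      rintro (_ | j)
      · exact hκ_none hbJ (hM b hb)
      · exact hκ_some j (hMJ j))
    (by
      intro A B hAB
      obtain ⟨x, hA, hB⟩ := (exists_common_face_iff hn).1 hAB
      by_cases hx : x ∈ J
      · rw [hκ_some ⟨x, hx⟩ hA, hκ_some ⟨x, hx⟩ hB]
      · rw [hκ_none hx hA, hκ_none hx hB])
    (by
      simp only [exists_common_face_iff hn]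
      intro A hA
      obtain ⟨-, x, hx⟩ := (mem_faces_iff hn _).1 hA
      replace hx := hx A (by simp)
      by_cases hxJ : x ∈ J
      · rw [hκ_some ⟨x, hxJ⟩ hx]
        exact .rel _ _ ⟨x, hx, hM x hx.mem_Icc⟩
      · rw [hκ_none hxJ hx]
        refine .trans _ (M x) _ (.rel _ _ ⟨x, hx, hM x hx.mem_Icc⟩) ?_
        change Relation.EqvGen _ (M x) (M b)
        exact hpath (hconn x hx.mem_Icc hxJ))
  obtain ⟨E⟩ := main
  exact ⟨E.trans (LinearEquiv.funCongrLeft ℤ ℤ J.equivFin.symm).toAddEquiv⟩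

/-- The isolated vertices for `4 ≤ n` are `1` and the primes in `(n / 2, n]`. -/
theorem reducedHomology_zero_equiv_of_four_le {n : ℕ} (hn : 4 ≤ n) :
    Nonempty ((coprimeFreeComplex n).ReducedHomology 0 ≃+
      (Fin (upperHalfPrimeCount n + 1) → ℤ)) := by
  set P : Finset ℕ := {p ∈ Finset.Icc 1 n | n < 2 * p ∧ p.Prime} with hP
  have h1P : 1 ∉ P := by simp [hP, Nat.not_prime_one]
  have hcard : (insert 1 P).card = upperHalfPrimeCount n + 1 := by
    rw [Finset.card_insert_of_notMem h1P, upperHalfPrimeCount]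
  rw [← hcard]
  refine reducedHomology_zero_equiv_of_isolated _ 2 ?_ ?_ ?_ ?_ ?_
  · rw [Finset.insert_subset_iff]
    exact ⟨Finset.mem_Icc.2 (by omega), Finset.filter_subset _ _⟩
  · exact Finset.mem_Icc.2 (by omega)
  · simp [hP]; omega
  · intro j hj x hx hjx
    rcases Finset.mem_insert.1 hj with rfl | hj
    · simp at hjx
    · obtain ⟨-, hnj, hp⟩ := Finset.mem_filter.1 hj
      have hdvd : j ∣ x := by
        by_contra h
        exact hjx.ne' ((Nat.Prime.coprime_iff_not_dvd hp).2 h)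
      obtain ⟨a, rfl⟩ := hdvd
      rw [Finset.mem_Icc] at hx
      have ha : a ≠ 0 := by rintro rfl; simp at hx
      have : a < 2 := by nlinarith
      obtain rfl : a = 1 := by omega
      simp
  · intro x hx hxJ
    have hx' := Finset.mem_Icc.1 hx
    simp only [Finset.mem_insert, not_or] at hxJ
    obtain ⟨p, hp, hpx⟩ := Nat.exists_prime_and_dvd hxJ.1
    have hp2 := hp.two_le
    have hpn : 2 * p ≤ n := by
      by_contra! h
      obtain ⟨a, rfl⟩ := hpx
      have ha : a ≠ 0 := by rintro rfl; simp at hx'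
      have : a < 2 := by nlinarith
      obtain rfl : a = 1 := by omega
      rw [mul_one] at hx hxJ
      exact hxJ.2 (Finset.mem_filter.2 ⟨hx, h, hp⟩)
    have h2p : 2 * p ∈ Finset.Icc 1 n := Finset.mem_Icc.2 (by omega)
    exact .trans _ (2 * p) _ (.rel _ _ ⟨hx, h2p, one_lt_gcd_of_prime_dvd hp hpx (by simp) (by omega)⟩)
      (.rel _ _ ⟨h2p, Finset.mem_Icc.2 (by omega), one_lt_gcd_of_prime_dvd Nat.prime_two (by simp) (by simp)
        (by omega)⟩)

/-- For `n ≤ 3` all vertices are isolated. -/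
theorem reducedHomology_zero_equiv_of_le_three {n : ℕ} (hn : 1 ≤ n) (hn3 : n ≤ 3) :
    Nonempty ((coprimeFreeComplex n).ReducedHomology 0 ≃+ (Fin (n - 1) → ℤ)) := by
  have := reducedHomology_zero_equiv_of_isolated (n := n) (Finset.Icc 2 n) 1
    (Finset.Icc_subset_Icc_left (by norm_num)) (by simpa using hn) (by simp)
    (by interval_cases n <;> decide)
    (by
      intro x hx hxJ
      rw [Finset.mem_Icc] at hx hxJ
      obtain rfl : x = 1 := by omega
      exact .refl _)
  rwa [Nat.card_Icc, show n + 1 - 2 = n - 1 by omega] at this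

theorem proposition7 :
    Subsingleton ((coprimeFreeComplex 1).ReducedHomology 0) ∧
    Nonempty ((coprimeFreeComplex 2).ReducedHomology 0 ≃+ ℤ) ∧
    Nonempty ((coprimeFreeComplex 3).ReducedHomology 0 ≃+ (Fin 2 → ℤ)) ∧
    (∀ n : ℕ, 4 ≤ n →
      Nonempty ((coprimeFreeComplex n).ReducedHomology 0 ≃+
        (Fin (upperHalfPrimeCount n + 1) → ℤ))) ∧
    (∀ n : ℕ, 1 ≤ n → Subsingleton ((coprimeFreeComplex n).ReducedHomology 1)) := by
  refine ⟨?_, ?_, reducedHomology_zero_equiv_of_le_three (n := 3) (by norm_num) le_rfl,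
    fun n hn => reducedHomology_zero_equiv_of_four_le hn,
    fun n hn => subsingleton_reducedHomology_one_coprimeFreeComplex hn⟩
  · obtain ⟨E⟩ := reducedHomology_zero_equiv_of_le_three (n := 1) le_rfl (by norm_num)
    have : Subsingleton (Fin (1 - 1) → ℤ) := inferInstanceAs (Subsingleton (Fin 0 → ℤ))
    exact E.toEquiv.subsingleton
  · obtain ⟨E⟩ := reducedHomology_zero_equiv_of_le_three (n := 2) (by norm_num) (by norm_num)
    exact ⟨E.trans (LinearEquiv.funUnique (Fin 1) ℤ ℤ).toAddEquiv⟩
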